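/- Let $G$ be a countable discrete group, let $n$ be a natural number, let $\nu: G \to \mathcal{U}(M_n)$ be a unitary representation of $G$ on the matrix algebra $M_n = M_n(\mathbb{C})$, and let $\operatorname{Ad}(\nu)$ denote the action $g \mapsto (x \mapsto \nu_g x \nu_g^*)$ of $G$ on $M_n$. Let $B$ be a unital $C^*$-algebra with an action $\beta: G \curvearrowright B$ by $*$-automorphisms. Suppose that $\psi_1, \ldots, \psi_m : M_n \to B$ are completely positive contractive order zero maps (order zero: $\psi_j(a)\psi_j(b) = 0$ whenever $a, b \in M_n$ are positive with $ab = 0$) such that 1. each $\psi_j$ is equivariant, i.e. $\psi_j(\nu_g x \nu_g^*) = \beta_g(\psi_j(x))$ for all $g \in G$ and $x \in M_n$; 2. the ranges commute pairwise, i.e. $\psi_i(x)\psi_j(y) = \psi_j(y)\psi_i(x)$ for all $i \neq j$ and $x, y \in M_n$; 3. $\sum_{j=1}^m \psi_j(1) = 1_B$. Then there exists a unital $*$-homomorphism $\Psi: M_n \to B$ that is equivariant, i.e. $\Psi(\nu_g x \nu_g^*) = \beta_g(\Psi(x))$ for all $g \in G$ and $x \in M_n$. -/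

import Mathlib

open scoped CStarAlgebra ComplexOrder

/-- A completely positive map `φ : A → B` of C⋆-algebras is a *c.p.c. order zero map* if it is
contractive and sends orthogonal positive elements to orthogonal elements. (For positive `a`, `b`,
and hence positive `φ a`, `φ b`, orthogonality just says that the product vanishes.) -/
structure IsCPCOrderZero {A B : Type*} [NonUnitalCStarAlgebra A] [PartialOrder A]
    [StarOrderedRing A] [NonUnitalCStarAlgebra B] [PartialOrder B] [StarOrderedRing B]
    (φ : A →CP B) : Prop where
  contractive : ∀ a : A, ‖φ a‖ ≤ ‖a‖
  orderZero : ∀ a b : A, 0 ≤ a → 0 ≤ b → a * b = 0 → φ a * φ b = 0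

/-- The action of `G` by inner automorphisms `x ↦ ν g * x * star (ν g)` induced by a unitary
representation `ν` of `G` in the C⋆-algebra `A`. -/
noncomputable def adAction {G A : Type*} [Group G] [CStarAlgebra A] (ν : G →* unitary A) :
    G →* (A ≃⋆ₐ[ℂ] A) :=
  (Unitary.conjStarAlgAut ℂ A).comp ν

/-- A map `f : A → B` is equivariant for the actions `α` and `β` of `G` by `*`-automorphisms. -/
def IsEquivariant {G A B : Type*} [Group G] [CStarAlgebra A] [CStarAlgebra B]
    (α : G →* (A ≃⋆ₐ[ℂ] A)) (β : G →* (B ≃⋆ₐ[ℂ] B)) (f : A → B) : Prop :=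
  ∀ (g : G) (a : A), f (α g a) = β g (f a)

/-! On `M_n` a c.p.c. order zero map satisfies `φ x * φ y = φ 1 * φ (x * y)`, so it becomes a unital
`*`-homomorphism after division by `φ 1` once `φ 1` is invertible. The task is to merge the `ψ j`
into one such map. Two maps with commuting ranges are merged by `IsAlgOrderZero.exists_join`. With
`a = φ₁ 1`, `b = φ₂ 1`, a correction built from the commutator of `x ⊗ 1` with the tensor flip is
added to `a(a+3b)φ₁ + b(b+3a)φ₂`. The result again satisfies the identity, has value `(a+b)^3` at
`1`, and is equivariant because the flip is fixed by `Ad(u ⊗ u)`. Whatever commutes with both maps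
commutes with it, so merging can be iterated (`exists_isAlgOrderZero_of_commuting`); a scalar lower
bound on the sum of the values at `1` survives each cubing. -/

open scoped TensorProduct

/-! ### Completely positive maps and zero products -/

section CompletelyPositive

variable {A B : Type*} [CStarAlgebra A] [PartialOrder A] [StarOrderedRing A]
  [CStarAlgebra B] [PartialOrder B] [StarOrderedRing B]

/-- Compressing a positive `2 × 2` matrix by the column `(1, -c)`. -/
theorem CStarMatrix.compress_nonneg {M : CStarMatrix (Fin 2) (Fin 2) B} (hM : 0 ≤ M) (c : B) :
    0 ≤ M 0 0 - M 0 1 * c - star c * M 1 0 + star c * M 1 1 * c := by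
  rw [StarOrderedRing.nonneg_iff] at hM
  induction hM using AddSubmonoid.closure_induction with
  | zero => simp
  | add M N _ _ hM hN =>
    refine (add_nonneg hM hN).trans_eq ?_
    simp only [CStarMatrix.add_apply]
    noncomm_ring
  | mem M hM =>
  obtain ⟨N, rfl⟩ := hM
  dsimp only
  have key : ∀ i j, (star N * N) i j = star (N 0 i) * N 0 j + star (N 1 i) * N 1 j := by
    intro i j
    rw [CStarMatrix.mul_apply, Fin.sum_univ_two]
    rfl
  have h := add_nonneg (star_mul_self_nonneg (N 0 0 - N 0 1 * c))
    (star_mul_self_nonneg (N 1 0 - N 1 1 * c))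
  convert h using 1
  simp only [key, star_sub, star_mul]
  noncomm_ring

theorem CompletelyPositiveMap.map_star (φ : A →CP B) (x : A) : φ (star x) = star (φ x) := by
  let f : A →ₚ[ℂ] B := PositiveLinearMap.mk₀ (φ : A →ₗ[ℂ] B) fun a ha ↦ by
    simpa using OrderHomClass.mono φ ha
  exact StarHomClass.map_star f x

/-- The Kadison–Schwarz inequality. -/
theorem CompletelyPositiveMap.star_mul_self_le (φ : A →CP B) (h1 : φ 1 ≤ 1) (x : A) :
    star (φ x) * φ x ≤ φ (star x * x) := by
  -- `star N * N` has rows `(x⋆x, x⋆)` and `(x, 1)`; its image under `φ` is compressed by `(1, -φ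
  -- x)`.
  let N : CStarMatrix (Fin 2) (Fin 2) A := CStarMatrix.ofMatrix !![x, 1; 0, 0]
  have hM : 0 ≤ (star N * N).map φ := φ.map_cstarMatrix_nonneg _ (star_mul_self_nonneg N)
  have key : ∀ i j, (star N * N) i j = star (N 0 i) * N 0 j + star (N 1 i) * N 1 j := by
    intro i j
    rw [CStarMatrix.mul_apply, Fin.sum_univ_two]
    rfl
  have h := CStarMatrix.compress_nonneg hM (φ x)
  simp only [CStarMatrix.map_apply, key, N, CStarMatrix.ofMatrix_apply, Matrix.of_apply,
    Matrix.cons_val_zero, Matrix.cons_val_one, Matrix.cons_val', Matrix.cons_val_fin_one,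
    star_zero, mul_zero, add_zero, star_one, mul_one, one_mul, φ.map_star] at h
  have h2 : star (φ x) * φ 1 * φ x ≤ star (φ x) * φ x := by
    simpa using star_left_conjugate_le_conjugate h1 (φ x)
  have h3 := add_le_add h h2
  rw [← sub_nonneg] at h3 ⊢
  convert h3 using 1
  abel

theorem IsCPCOrderZero.map_one_le {φ : A →CP B} (hφ : IsCPCOrderZero φ) : φ 1 ≤ 1 := by
  have h0 : 0 ≤ φ 1 := by simpa using OrderHomClass.mono φ (zero_le_one (α := A))
  rw [← CStarAlgebra.norm_le_one_iff_of_nonneg _ h0]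
  refine (hφ.contractive 1).trans ?_
  rcases subsingleton_or_nontrivial A with h | h
  · rw [Subsingleton.elim (1 : A) 0, norm_zero]
    exact zero_le_one
  · exact CStarRing.norm_one.le

/-- Order zero maps preserve all zero products, not only those of positive elements. -/
theorem IsCPCOrderZero.mul_eq_zero {φ : A →CP B} (hφ : IsCPCOrderZero φ) {x y : A}
    (hxy : x * y = 0) : φ x * φ y = 0 := by
  -- `x⋆x` and `yy⋆` are positive and orthogonal, and their images dominate `φ(x)⋆φ(x)` and
  -- `φ(y)φ(y)⋆`.
  have hC := φ.star_mul_self_le hφ.map_one_le x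
  have hD : φ y * star (φ y) ≤ φ (y * star y) := by
    simpa [φ.map_star] using φ.star_mul_self_le hφ.map_one_le (star y)
  have h0 : φ (star x * x) * φ (y * star y) = 0 :=
    hφ.orderZero _ _ (star_mul_self_nonneg x) (mul_star_self_nonneg y) <| by
      rw [mul_assoc, ← mul_assoc x, hxy, zero_mul, mul_zero]
  have hsa : star (φ (star x * x)) = φ (star x * x) := by
    rw [← φ.map_star, star_mul, star_star]
  have h1 : φ (star x * x) * φ y = 0 := by
    rw [← CStarRing.mul_star_self_eq_zero_iff]
    refine le_antisymm ?_ (mul_star_self_nonneg _)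
    have h := star_right_conjugate_le_conjugate hD (φ (star x * x))
    rw [h0, zero_mul] at h
    simpa [mul_assoc] using h
  rw [← CStarRing.star_mul_self_eq_zero_iff]
  refine le_antisymm ?_ (star_mul_self_nonneg _)
  have h := star_left_conjugate_le_conjugate hC (φ y)
  rw [mul_assoc (star (φ y)) (φ (star x * x)), h1, mul_zero] at h
  simpa [mul_assoc] using h

end CompletelyPositive

/-! ### Multiplicativity from zero products -/

/-- A linear map preserving zero products on an algebra spanned by its idempotents is
multiplicative up to the factor `φ 1`. -/
theorem LinearMap.mul_eq_of_mul_eq_zero {A B : Type*} [Ring A] [Algebra ℂ A] [Ring B] [Algebra ℂ B]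
    (hA : Submodule.span ℂ {e : A | IsIdempotentElem e} = ⊤) (φ : A →ₗ[ℂ] B)
    (hφ : ∀ x y, x * y = 0 → φ x * φ y = 0) (x y : A) : φ x * φ y = φ 1 * φ (x * y) := by
  have key : ∀ z ∈ Submodule.span ℂ {e : A | IsIdempotentElem e},
      φ z * φ y = φ 1 * φ (z * y) := by
    intro z hz
    induction hz using Submodule.span_induction with
    | mem e he =>
      have he : e * e = e := he
      -- Both `φ e * φ y` and `φ 1 * φ (e * y)` equal `φ e * φ (e * y)`.
      have h1 := hφ e ((1 - e) * y) (by rw [← mul_assoc, mul_sub, he, mul_one, sub_self, zero_mul])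
      have h2 := hφ (1 - e) (e * y) (by rw [← mul_assoc, sub_mul, he, one_mul, sub_self, zero_mul])
      rw [sub_mul, one_mul, map_sub, mul_sub, sub_eq_zero] at h1
      rw [map_sub, sub_mul, sub_eq_zero] at h2
      rw [h1, h2]
    | zero => simp
    | add u v _ _ hu hv => simp [add_mul, mul_add, hu, hv]
    | smul c u _ hu => simp [hu]
  exact key x (hA ▸ Submodule.mem_top)

theorem Matrix.span_isIdempotentElem (n : ℕ) :
    Submodule.span ℂ {e : Matrix (Fin n) (Fin n) ℂ | IsIdempotentElem e} = ⊤ := by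
  rw [eq_top_iff]
  rintro x -
  rw [Matrix.matrix_eq_sum_single x]
  refine Submodule.sum_mem _ fun i _ ↦ Submodule.sum_mem _ fun j _ ↦ ?_
  rw [← mul_one (x i j), ← smul_eq_mul, ← Matrix.smul_single]
  refine Submodule.smul_mem _ _ ?_
  have hd : IsIdempotentElem (Matrix.single i i (1 : ℂ)) := by
    simp [IsIdempotentElem]
  by_cases hij : i = j
  · subst hij
    exact Submodule.subset_span hd
  -- For `i ≠ j`, `e_ij` is the difference of the idempotents `e_ii + e_ij` and `e_ii`.
  · have h : IsIdempotentElem (Matrix.single i i (1 : ℂ) + Matrix.single i j (1 : ℂ)) := by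
      simp [IsIdempotentElem, mul_add, add_mul, Matrix.single_mul_single_of_ne, Ne.symm hij]
    have := Submodule.sub_mem (Submodule.span ℂ {e | IsIdempotentElem e})
      (Submodule.subset_span h) (Submodule.subset_span hd)
    rwa [add_sub_cancel_left] at this

theorem CStarMatrix.span_isIdempotentElem (n : ℕ) :
    Submodule.span ℂ {e : CStarMatrix (Fin n) (Fin n) ℂ | IsIdempotentElem e} = ⊤ :=
  Matrix.span_isIdempotentElem n

/-! ### The tensor flip and its commutators -/

theorem Matrix.exists_flip (n : ℕ) :
    ∃ F : Matrix (Fin n) (Fin n) ℂ ⊗[ℂ] Matrix (Fin n) (Fin n) ℂ,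
      F * F = 1 ∧ star F = F ∧ ∀ x y, F * (x ⊗ₜ[ℂ] y) = (y ⊗ₜ[ℂ] x) * F := by
  let E (i j : Fin n) : Matrix (Fin n) (Fin n) ℂ := Matrix.single i j 1
  have hE : ∀ i j k l, E i j * E k l = if j = k then E i l else 0 := by
    intro i j k l
    by_cases h : j = k
    · subst h; simp [E]
    · simp [E, h]
  have hx : ∀ x : Matrix (Fin n) (Fin n) ℂ, x = ∑ i, ∑ j, x i j • E i j := by
    intro x
    conv_lhs => rw [Matrix.matrix_eq_sum_single x]
    simp [E]
  let F := ∑ i, ∑ j, E i j ⊗ₜ[ℂ] E j i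
  have hF : ∀ k l p q, F * (E k l ⊗ₜ[ℂ] E p q) = E p l ⊗ₜ[ℂ] E k q := by
    intro k l p q
    simp [F, Finset.sum_mul, hE, TensorProduct.ite_tmul, TensorProduct.tmul_ite]
  have hF' : ∀ k l p q, (E p q ⊗ₜ[ℂ] E k l) * F = E p l ⊗ₜ[ℂ] E k q := by
    intro k l p q
    simp [F, Finset.mul_sum, hE, TensorProduct.ite_tmul, TensorProduct.tmul_ite]
  have h1 : (1 : Matrix (Fin n) (Fin n) ℂ) = ∑ i, E i i := by
    rw [hx 1]
    simp [Matrix.one_apply]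
  refine ⟨F, ?_, ?_, ?_⟩
  · have : F * F = ∑ i, ∑ j, E j j ⊗ₜ[ℂ] E i i := by
      conv_lhs => rw [show F = ∑ i, ∑ j, E i j ⊗ₜ[ℂ] E j i from rfl, Finset.mul_sum]
      simp only [Finset.mul_sum, ← show F = ∑ i, ∑ j, E i j ⊗ₜ[ℂ] E j i from rfl, hF]
    rw [this, Algebra.TensorProduct.one_def, h1, TensorProduct.sum_tmul, Finset.sum_comm]
    simp only [TensorProduct.tmul_sum]
  · have hs : ∀ i j, star (E i j) = E j i := by
      intro i j
      simp [E, Matrix.star_eq_conjTranspose]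
    simp only [F, star_sum, TensorProduct.star_tmul, hs]
    exact Finset.sum_comm
  · have hy : ∀ k l y, F * (E k l ⊗ₜ[ℂ] y) = (y ⊗ₜ[ℂ] E k l) * F := by
      intro k l y
      rw [hx y]
      simp only [TensorProduct.sum_tmul, TensorProduct.tmul_sum, Finset.mul_sum, Finset.sum_mul,
        ← TensorProduct.smul_tmul', TensorProduct.tmul_smul, mul_smul_comm, smul_mul_assoc, hF, hF']
    intro x y
    rw [hx x]
    simp only [TensorProduct.sum_tmul, TensorProduct.tmul_sum, Finset.mul_sum, Finset.sum_mul,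
      ← TensorProduct.smul_tmul', TensorProduct.tmul_smul, mul_smul_comm, smul_mul_assoc, hy]

theorem CStarMatrix.exists_flip (n : ℕ) :
    ∃ F : CStarMatrix (Fin n) (Fin n) ℂ ⊗[ℂ] CStarMatrix (Fin n) (Fin n) ℂ,
      F * F = 1 ∧ star F = F ∧ ∀ x y, F * (x ⊗ₜ[ℂ] y) = (y ⊗ₜ[ℂ] x) * F :=
  Matrix.exists_flip n

/-- Completely positive order zero maps out of matrix algebras, in algebraic terms. -/
structure IsAlgOrderZero {A B : Type*} [Ring A] [StarRing A] [Algebra ℂ A]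
    [CStarAlgebra B] [PartialOrder B] (φ : A →ₗ[ℂ] B) : Prop where
  map_star : ∀ x, φ (star x) = star (φ x)
  map_mul : ∀ x y, φ x * φ y = φ 1 * φ (x * y)
  map_one_nonneg : 0 ≤ φ 1

theorem IsCPCOrderZero.isAlgOrderZero {n : ℕ} {B : Type*} [CStarAlgebra B] [PartialOrder B]
    [StarOrderedRing B] {φ : CStarMatrix (Fin n) (Fin n) ℂ →CP B} (hφ : IsCPCOrderZero φ) :
    IsAlgOrderZero (φ : CStarMatrix (Fin n) (Fin n) ℂ →ₗ[ℂ] B) where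
  map_star := φ.map_star
  map_mul := LinearMap.mul_eq_of_mul_eq_zero (CStarMatrix.span_isIdempotentElem n) _
    fun _ _ h ↦ hφ.mul_eq_zero h
  map_one_nonneg := by
    simpa using OrderHomClass.mono φ (zero_le_one (α := CStarMatrix (Fin n) (Fin n) ℂ))

section FlipCommutator

variable {A : Type*} [Ring A] [Algebra ℂ A]

/-- The linear map `x ↦ F (x ⊗ 1) - (x ⊗ 1) F`. -/
noncomputable def tensorCommutator (F : A ⊗[ℂ] A) : A →ₗ[ℂ] A ⊗[ℂ] A :=
  (LinearMap.mulLeft ℂ F - LinearMap.mulRight ℂ F) ∘ₗ (TensorProduct.mk ℂ A A).flip 1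

theorem tensorCommutator_apply (F : A ⊗[ℂ] A) (x : A) :
    tensorCommutator F x = F * (x ⊗ₜ 1) - (x ⊗ₜ 1) * F := rfl

theorem tensorCommutator_one (F : A ⊗[ℂ] A) : tensorCommutator F 1 = 0 := by
  rw [tensorCommutator_apply, ← Algebra.TensorProduct.one_def, mul_one, one_mul, sub_self]

/-- This sign is why the correction term in `joinMap` carries a factor `Complex.I`. -/
theorem tensorCommutator_star [StarRing A] [StarModule ℂ A] {F : A ⊗[ℂ] A} (hF : star F = F)
    (x : A) : tensorCommutator F (star x) = -star (tensorCommutator F x) := by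
  simp [tensorCommutator_apply, hF]

theorem tensorCommutator_leibniz (F : A ⊗[ℂ] A) (x y : A) :
    (x ⊗ₜ[ℂ] 1) * tensorCommutator F y + tensorCommutator F x * (y ⊗ₜ[ℂ] 1) =
      tensorCommutator F (x * y) := by
  have h : (x * y) ⊗ₜ[ℂ] (1 : A) = (x ⊗ₜ[ℂ] 1) * (y ⊗ₜ[ℂ] 1) := by simp
  rw [tensorCommutator_apply, tensorCommutator_apply, tensorCommutator_apply, h]
  noncomm_ring

/-- The flip relation gives `[F, x ⊗ 1] = -[F, 1 ⊗ x]`, so the same map is a derivation for either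
leg. -/
theorem tensorCommutator_leibniz' {F : A ⊗[ℂ] A}
    (hF : ∀ x y, F * (x ⊗ₜ[ℂ] y) = (y ⊗ₜ[ℂ] x) * F) (x y : A) :
    ((1 : A) ⊗ₜ[ℂ] x) * tensorCommutator F y + tensorCommutator F x * ((1 : A) ⊗ₜ[ℂ] y) =
      tensorCommutator F (x * y) := by
  simp only [tensorCommutator_apply, mul_sub, sub_mul, mul_assoc, hF]
  simp only [← mul_assoc, Algebra.TensorProduct.tmul_mul_tmul, mul_one, one_mul]
  abel

theorem tensorCommutator_mul {F : A ⊗[ℂ] A} (hFF : F * F = 1)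
    (hF : ∀ x y, F * (x ⊗ₜ[ℂ] y) = (y ⊗ₜ[ℂ] x) * F) (x y : A) :
    tensorCommutator F x * tensorCommutator F y =
      x ⊗ₜ y + y ⊗ₜ x - (x * y) ⊗ₜ 1 - 1 ⊗ₜ (x * y) := by
  have h₁ : tensorCommutator F x = (1 ⊗ₜ x - x ⊗ₜ 1) * F := by
    rw [tensorCommutator_apply, hF, sub_mul]
  have h₂ : tensorCommutator F y = F * (y ⊗ₜ 1 - 1 ⊗ₜ y) := by
    rw [tensorCommutator_apply, ← hF, mul_sub]
  rw [h₁, h₂, mul_assoc, ← mul_assoc F F, hFF, one_mul]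
  simp only [mul_sub, sub_mul, Algebra.TensorProduct.tmul_mul_tmul, mul_one, one_mul]
  abel

end FlipCommutator

/-! ### Products of two commuting order zero maps -/

section MulTensor

variable {A B : Type*} [Ring A] [StarRing A] [Algebra ℂ A] [CStarAlgebra B] [PartialOrder B]
  {φ φ₁ φ₂ : A →ₗ[ℂ] B}

theorem IsAlgOrderZero.commute_map_one (h : IsAlgOrderZero φ) (x : A) : Commute (φ 1) (φ x) := by
  have := h.map_mul x 1
  rw [mul_one] at this
  exact this.symm

/-- The linear map `x ⊗ y ↦ φ₁ x * φ₂ y`. -/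
noncomputable def mulTensor {A B : Type*} [Ring A] [Algebra ℂ A] [Ring B] [Algebra ℂ B]
    (φ₁ φ₂ : A →ₗ[ℂ] B) : A ⊗[ℂ] A →ₗ[ℂ] B :=
  TensorProduct.lift ((LinearMap.mul ℂ B).compl₁₂ φ₁ φ₂)

@[simp]
theorem mulTensor_tmul {A B : Type*} [Ring A] [Algebra ℂ A] [Ring B] [Algebra ℂ B]
    (φ₁ φ₂ : A →ₗ[ℂ] B) (x y : A) : mulTensor φ₁ φ₂ (x ⊗ₜ y) = φ₁ x * φ₂ y := rfl

theorem commute_mulTensor {A B : Type*} [Ring A] [Algebra ℂ A] [Ring B] [Algebra ℂ B]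
    {φ₁ φ₂ : A →ₗ[ℂ] B} {z : B} (hz₁ : ∀ x, Commute z (φ₁ x)) (hz₂ : ∀ x, Commute z (φ₂ x))
    (w : A ⊗[ℂ] A) : Commute z (mulTensor φ₁ φ₂ w) := by
  induction w with
  | zero => simp
  | add u v hu hv => rw [map_add]; exact hu.add_right hv
  | tmul x y => exact (hz₁ x).mul_right (hz₂ y)

theorem mulTensor_star [StarModule ℂ A] (h₁ : IsAlgOrderZero φ₁) (h₂ : IsAlgOrderZero φ₂)
    (hc : ∀ x y, Commute (φ₁ x) (φ₂ y)) (z : A ⊗[ℂ] A) :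
    mulTensor φ₁ φ₂ (star z) = star (mulTensor φ₁ φ₂ z) := by
  induction z with
  | zero => simp
  | add z w hz hw => simp [hz, hw]
  | tmul x y => simp [h₁.map_star, h₂.map_star, ← star_mul, (hc x y).eq]

theorem mulTensor_mul (h₁ : IsAlgOrderZero φ₁) (h₂ : IsAlgOrderZero φ₂)
    (hc : ∀ x y, Commute (φ₁ x) (φ₂ y)) (z w : A ⊗[ℂ] A) :
    mulTensor φ₁ φ₂ z * mulTensor φ₁ φ₂ w = φ₁ 1 * φ₂ 1 * mulTensor φ₁ φ₂ (z * w) := by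
  induction z with
  | zero => simp
  | add z z' hz hz' => simp [add_mul, mul_add, hz, hz']
  | tmul x y =>
    induction w with
    | zero => simp
    | add w w' hw hw' => simp only [mul_add, map_add, hw, hw']
    | tmul u v =>
      simp only [Algebra.TensorProduct.tmul_mul_tmul, mulTensor_tmul]
      rw [(hc u y).symm.mul_mul_mul_comm, h₁.map_mul, h₂.map_mul,
        (hc _ 1).mul_mul_mul_comm]

theorem map_mul_mulTensor (h₁ : IsAlgOrderZero φ₁) (x : A) (z : A ⊗[ℂ] A) :
    φ₁ x * mulTensor φ₁ φ₂ z = φ₁ 1 * mulTensor φ₁ φ₂ ((x ⊗ₜ 1) * z) := by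
  induction z with
  | zero => simp
  | add z w hz hw => simp [mul_add, hz, hw]
  | tmul u v => simp [← mul_assoc, h₁.map_mul]

theorem mulTensor_mul_map (h₁ : IsAlgOrderZero φ₁) (hc : ∀ x y, Commute (φ₁ x) (φ₂ y))
    (x : A) (z : A ⊗[ℂ] A) :
    mulTensor φ₁ φ₂ z * φ₁ x = φ₁ 1 * mulTensor φ₁ φ₂ (z * (x ⊗ₜ 1)) := by
  induction z with
  | zero => simp
  | add z w hz hw => simp [mul_add, add_mul, hz, hw]
  | tmul u v =>
    simp only [Algebra.TensorProduct.tmul_mul_tmul, mulTensor_tmul, mul_one]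
    rw [mul_assoc, ← (hc x v).eq, ← mul_assoc, h₁.map_mul, mul_assoc]

theorem map_mul_mulTensor' (h₂ : IsAlgOrderZero φ₂) (hc : ∀ x y, Commute (φ₁ x) (φ₂ y))
    (x : A) (z : A ⊗[ℂ] A) :
    φ₂ x * mulTensor φ₁ φ₂ z = φ₂ 1 * mulTensor φ₁ φ₂ ((1 ⊗ₜ x) * z) := by
  induction z with
  | zero => simp
  | add z w hz hw => simp [mul_add, hz, hw]
  | tmul u v =>
    simp only [Algebra.TensorProduct.tmul_mul_tmul, mulTensor_tmul, one_mul]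
    rw [(hc u x).symm.left_comm, (hc u 1).symm.left_comm, h₂.map_mul]

theorem mulTensor_mul_map' (h₂ : IsAlgOrderZero φ₂) (hc : ∀ x y, Commute (φ₁ x) (φ₂ y))
    (x : A) (z : A ⊗[ℂ] A) :
    mulTensor φ₁ φ₂ z * φ₂ x = φ₂ 1 * mulTensor φ₁ φ₂ (z * (1 ⊗ₜ x)) := by
  induction z with
  | zero => simp
  | add z w hz hw => simp [mul_add, add_mul, hz, hw]
  | tmul u v =>
    simp only [Algebra.TensorProduct.tmul_mul_tmul, mulTensor_tmul, mul_one]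
    rw [mul_assoc, h₂.map_mul, (hc u 1).symm.left_comm]

end MulTensor

/-! ### The join of two order zero maps -/

/-- The bilinear expansion behind multiplicativity of `joinMap`: the coefficients `P`, `Q`, `E`
commute with everything in sight. -/
theorem joinMap_expansion {B : Type*} [Ring B] {P Q E : B} {u₁ u₂ v₁ v₂ w₁ w₂ : B}
    (hPQ : Commute P Q) (hPE : Commute P E) (hQE : Commute Q E)
    (hPu : Commute P u₁) (hQu : Commute Q u₁) (hEu : Commute E u₁)
    (hPv : Commute P v₁) (hQv : Commute Q v₁) (hEv : Commute E v₁)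
    (hPw : Commute P w₁) (hQw : Commute Q w₁) (hEw : Commute E w₁) :
    (P * u₁ + Q * v₁ + E * w₁) * (P * u₂ + Q * v₂ + E * w₂) =
      P * P * (u₁ * u₂) + Q * Q * (v₁ * v₂) + E * E * (w₁ * w₂) + P * Q * (u₁ * v₂ + v₁ * u₂) +
      E * P * (u₁ * w₂ + w₁ * u₂) + E * Q * (v₁ * w₂ + w₁ * v₂) := by
  simp only [add_mul, mul_add]
  rw [hPu.symm.mul_mul_mul_comm, hQu.symm.mul_mul_mul_comm, hEu.symm.mul_mul_mul_comm,
    hPv.symm.mul_mul_mul_comm, hQv.symm.mul_mul_mul_comm, hEv.symm.mul_mul_mul_comm,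
    hPw.symm.mul_mul_mul_comm, hQw.symm.mul_mul_mul_comm, hEw.symm.mul_mul_mul_comm,
    hPQ.eq, hPE.eq, hQE.eq]
  abel

section Join

variable {A B : Type*} [Ring A] [Algebra ℂ A] [Ring B] [Algebra ℂ B] {φ₁ φ₂ : A →ₗ[ℂ] B}

/-- The join of two order zero maps along the flip `F`. -/
noncomputable def joinMap (φ₁ φ₂ : A →ₗ[ℂ] B) (F : A ⊗[ℂ] A) (r : B) : A →ₗ[ℂ] B :=
  LinearMap.mulLeft ℂ (φ₁ 1 * (φ₁ 1 + 3 • φ₂ 1)) ∘ₗ φ₁ +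
    LinearMap.mulLeft ℂ (φ₂ 1 * (φ₂ 1 + 3 • φ₁ 1)) ∘ₗ φ₂ +
    LinearMap.mulLeft ℂ (Complex.I • r) ∘ₗ mulTensor φ₁ φ₂ ∘ₗ tensorCommutator F

theorem joinMap_apply (φ₁ φ₂ : A →ₗ[ℂ] B) (F : A ⊗[ℂ] A) (r : B) (x : A) :
    joinMap φ₁ φ₂ F r x = φ₁ 1 * (φ₁ 1 + 3 • φ₂ 1) * φ₁ x + φ₂ 1 * (φ₂ 1 + 3 • φ₁ 1) * φ₂ x +
      Complex.I • r * mulTensor φ₁ φ₂ (tensorCommutator F x) := rfl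

theorem joinMap_one (hc : ∀ x y, Commute (φ₁ x) (φ₂ y)) (F : A ⊗[ℂ] A) (r : B) :
    joinMap φ₁ φ₂ F r 1 = (φ₁ 1 + φ₂ 1) ^ 3 := by
  have h : φ₂ 1 * φ₁ 1 = φ₁ 1 * φ₂ 1 := (hc 1 1).eq.symm
  have h' : ∀ z, φ₂ 1 * (φ₁ 1 * z) = φ₁ 1 * (φ₂ 1 * z) := fun z ↦ (hc 1 1).symm.left_comm z
  rw [joinMap_apply, tensorCommutator_one, map_zero, mul_zero, add_zero]
  simp only [pow_succ, pow_zero, one_mul, mul_add, add_mul, mul_assoc, h, h', mul_smul_comm,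
    smul_mul_assoc]
  abel

theorem commute_joinMap {F : A ⊗[ℂ] A} {r z : B} (hr : Commute z r)
    (hz₁ : ∀ x, Commute z (φ₁ x)) (hz₂ : ∀ x, Commute z (φ₂ x)) (x : A) :
    Commute z (joinMap φ₁ φ₂ F r x) := by
  have h₁ := hz₁ 1
  have h₂ := hz₂ 1
  rw [joinMap_apply]
  refine ((Commute.mul_right ?_ (hz₁ x)).add_right (Commute.mul_right ?_ (hz₂ x))).add_right
    ((hr.smul_right _).mul_right (commute_mulTensor hz₁ hz₂ _))
  · exact h₁.mul_right (h₁.add_right (h₂.smul_right 3))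
  · exact h₂.mul_right (h₂.add_right (h₁.smul_right 3))

theorem joinMap_equivariant {F : A ⊗[ℂ] A} {r : B} (α : A →ₐ[ℂ] A) (β : B →ₐ[ℂ] B)
    (hF : Algebra.TensorProduct.map α α F = F) (hr : β r = r)
    (h₁ : ∀ x, φ₁ (α x) = β (φ₁ x)) (h₂ : ∀ x, φ₂ (α x) = β (φ₂ x)) (x : A) :
    joinMap φ₁ φ₂ F r (α x) = β (joinMap φ₁ φ₂ F r x) := by
  have e₁ : β (φ₁ 1) = φ₁ 1 := by rw [← h₁, map_one]
  have e₂ : β (φ₂ 1) = φ₂ 1 := by rw [← h₂, map_one]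
  have hT : ∀ z, mulTensor φ₁ φ₂ (Algebra.TensorProduct.map α α z) = β (mulTensor φ₁ φ₂ z) := by
    intro z
    induction z with
    | zero => simp
    | add z w hz hw => simp only [map_add, hz, hw]
    | tmul x y => simp [h₁, h₂]
  have hD : tensorCommutator F (α x) = Algebra.TensorProduct.map α α (tensorCommutator F x) := by
    simp [tensorCommutator_apply, hF]
  simp only [joinMap_apply, hD, hT, map_add, map_mul, map_smul, map_nsmul, e₁, e₂, hr, h₁, h₂]

/-- The flip commutes with `u ⊗ u`. -/
theorem flip_map_conj {F : A ⊗[ℂ] A} (hF : ∀ x y, F * (x ⊗ₜ[ℂ] y) = (y ⊗ₜ[ℂ] x) * F)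
    {u v : A} (huv : u * v = 1) (α : A →ₐ[ℂ] A) (hα : ∀ x, α x = u * x * v) :
    Algebra.TensorProduct.map α α F = F := by
  have h : ∀ z, Algebra.TensorProduct.map α α z = (u ⊗ₜ u) * z * (v ⊗ₜ v) := by
    intro z
    induction z with
    | zero => simp
    | add z w hz hw => simp only [map_add, hz, hw, mul_add, add_mul]
    | tmul x y => simp [hα]
  rw [h, mul_assoc, hF, ← mul_assoc, Algebra.TensorProduct.tmul_mul_tmul, huv,
    ← Algebra.TensorProduct.one_def, one_mul]

end Join

section Star

variable {A B : Type*} [Ring A] [StarRing A] [Algebra ℂ A] [CStarAlgebra B] [PartialOrder B]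
  {φ₁ φ₂ : A →ₗ[ℂ] B}

theorem joinMap_star [StarModule ℂ A] (h₁ : IsAlgOrderZero φ₁) (h₂ : IsAlgOrderZero φ₂)
    (hc : ∀ x y, Commute (φ₁ x) (φ₂ y)) {F : A ⊗[ℂ] A} (hF : star F = F) {r : B}
    (hr : IsSelfAdjoint r) (hr₁ : ∀ x, Commute r (φ₁ x)) (hr₂ : ∀ x, Commute r (φ₂ x)) (x : A) :
    joinMap φ₁ φ₂ F r (star x) = star (joinMap φ₁ φ₂ F r x) := by
  have e₁ : star (φ₁ 1) = φ₁ 1 := by rw [← h₁.map_star, star_one]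
  have e₂ : star (φ₂ 1) = φ₂ 1 := by rw [← h₂.map_star, star_one]
  have hab := hc 1 1
  have hP : IsSelfAdjoint (φ₁ 1 * (φ₁ 1 + 3 • φ₂ 1)) := by
    have : IsSelfAdjoint (φ₁ 1 + 3 • φ₂ 1) := by
      rw [isSelfAdjoint_iff, star_add, star_nsmul, e₁, e₂]
    exact (IsSelfAdjoint.commute_iff e₁ this).1 ((Commute.refl _).add_right (hab.smul_right 3))
  have hQ : IsSelfAdjoint (φ₂ 1 * (φ₂ 1 + 3 • φ₁ 1)) := by
    have : IsSelfAdjoint (φ₂ 1 + 3 • φ₁ 1) := by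
      rw [isSelfAdjoint_iff, star_add, star_nsmul, e₁, e₂]
    exact (IsSelfAdjoint.commute_iff e₂ this).1
      ((Commute.refl _).add_right (hab.symm.smul_right 3))
  have cP : Commute (φ₁ 1 * (φ₁ 1 + 3 • φ₂ 1)) (φ₁ (star x)) :=
    have c := h₁.commute_map_one (star x)
    c.mul_left (c.add_left ((hc _ _).symm.smul_left 3))
  have cQ : Commute (φ₂ 1 * (φ₂ 1 + 3 • φ₁ 1)) (φ₂ (star x)) :=
    have c := h₂.commute_map_one (star x)
    c.mul_left (c.add_left ((hc _ _).smul_left 3))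
  have cE : Commute r (mulTensor φ₁ φ₂ (star (tensorCommutator F x))) :=
    commute_mulTensor hr₁ hr₂ _
  rw [joinMap_apply, joinMap_apply, tensorCommutator_star hF, map_neg, star_add, star_add,
    star_mul _ (φ₁ x), star_mul _ (φ₂ x),
    star_mul (_ • r), star_smul, hP.star_eq, hQ.star_eq, hr.star_eq,
    ← h₁.map_star, ← h₂.map_star, ← mulTensor_star h₁ h₂ hc, cP.eq, cQ.eq,
    smul_mul_assoc, mul_smul_comm, mul_neg, cE.eq,
    show star Complex.I = -Complex.I from Complex.conj_I, neg_smul, smul_neg]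

/-- With `P = a(a+3b)`, `Q = b(b+3a)`, the mixed terms `φ₁ x * φ₂ y + φ₂ x * φ₁ y` cancel exactly
when `r² = (a+3b)(3a+b)`, which is `hr`. The coefficients of `φ₁ (x * y)`, `φ₂ (x * y)` and the
commutator term then acquire the common factor `Pa + Qb = (a+b)^3`. -/
theorem joinMap_mul (h₁ : IsAlgOrderZero φ₁) (h₂ : IsAlgOrderZero φ₂)
    (hc : ∀ x y, Commute (φ₁ x) (φ₂ y)) {F : A ⊗[ℂ] A} (hFF : F * F = 1)
    (hF : ∀ x y, F * (x ⊗ₜ[ℂ] y) = (y ⊗ₜ[ℂ] x) * F) {r : B}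
    (hr : r * r = 3 • ((φ₁ 1 + φ₂ 1) * (φ₁ 1 + φ₂ 1)) + 4 • (φ₁ 1 * φ₂ 1))
    (hr₁ : ∀ x, Commute r (φ₁ x)) (hr₂ : ∀ x, Commute r (φ₂ x)) (x y : A) :
    joinMap φ₁ φ₂ F r x * joinMap φ₁ φ₂ F r y =
      joinMap φ₁ φ₂ F r 1 * joinMap φ₁ φ₂ F r (x * y) := by
  rw [joinMap_one hc, joinMap_apply, joinMap_apply, joinMap_apply]
  have ha₁ := h₁.commute_map_one
  have hb₂ := h₂.commute_map_one
  have ha₂ := hc 1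
  have hb₁ := fun x ↦ (hc x 1).symm
  have haT := commute_mulTensor ha₁ ha₂
  have hbT := commute_mulTensor hb₁ hb₂
  have hrT := commute_mulTensor hr₁ hr₂
  have hra := hr₁ 1
  have hrb := hr₂ 1
  have hab := hc 1 1
  have m₁ := h₁.map_mul x y
  have m₂ := h₂.map_mul x y
  have m₃ : mulTensor φ₁ φ₂ (tensorCommutator F x) * mulTensor φ₁ φ₂ (tensorCommutator F y) =
      φ₁ 1 * φ₂ 1 * (φ₁ x * φ₂ y + φ₂ x * φ₁ y - φ₂ 1 * φ₁ (x * y) - φ₁ 1 * φ₂ (x * y)) := by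
    rw [mulTensor_mul h₁ h₂ hc, tensorCommutator_mul hFF hF]
    simp only [map_sub, map_add, mulTensor_tmul, (hc y x).eq, (hc (x * y) 1).eq]
  have m₄ : φ₁ x * mulTensor φ₁ φ₂ (tensorCommutator F y) +
      mulTensor φ₁ φ₂ (tensorCommutator F x) * φ₁ y =
      φ₁ 1 * mulTensor φ₁ φ₂ (tensorCommutator F (x * y)) := by
    rw [map_mul_mulTensor h₁, mulTensor_mul_map h₁ hc, ← mul_add, ← map_add,
      tensorCommutator_leibniz]
  have m₅ : φ₂ x * mulTensor φ₁ φ₂ (tensorCommutator F y) +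
      mulTensor φ₁ φ₂ (tensorCommutator F x) * φ₂ y =
      φ₂ 1 * mulTensor φ₁ φ₂ (tensorCommutator F (x * y)) := by
    rw [map_mul_mulTensor' h₂ hc, mulTensor_mul_map' h₂ hc, ← mul_add, ← map_add,
      tensorCommutator_leibniz' hF]
  have hE : (Complex.I • r) * (Complex.I • r) =
      -(3 • ((φ₁ 1 + φ₂ 1) * (φ₁ 1 + φ₂ 1)) + 4 • (φ₁ 1 * φ₂ 1)) := by
    rw [smul_mul_smul_comm, Complex.I_mul_I, hr, neg_one_smul]
  generalize mulTensor φ₁ φ₂ (tensorCommutator F (x * y)) = W at *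
  have hEa : Commute (Complex.I • r) (φ₁ 1) := hra.smul_left _
  have hEb : Commute (Complex.I • r) (φ₂ 1) := hrb.smul_left _
  have hP {z : B} (h : Commute z (φ₁ 1)) (h' : Commute z (φ₂ 1)) :
      Commute (φ₁ 1 * (φ₁ 1 + 3 • φ₂ 1)) z :=
    (h.mul_right (h.add_right (h'.smul_right 3))).symm
  have hQ {z : B} (h : Commute z (φ₁ 1)) (h' : Commute z (φ₂ 1)) :
      Commute (φ₂ 1 * (φ₂ 1 + 3 • φ₁ 1)) z :=
    (h'.mul_right (h'.add_right (h.smul_right 3))).symm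
  rw [joinMap_expansion (hP (hQ (.refl _) hab).symm.symm (hQ hab.symm (.refl _)).symm.symm)
    (hP hEa hEb) (hQ hEa hEb)
    (hP (ha₁ x).symm (hb₁ x).symm) (hQ (ha₁ x).symm (hb₁ x).symm) ((hr₁ x).smul_left _)
    (hP (ha₂ x).symm (hb₂ x).symm) (hQ (ha₂ x).symm (hb₂ x).symm) ((hr₂ x).smul_left _)
    (hP (haT _).symm (hbT _).symm) (hQ (haT _).symm (hbT _).symm) ((hrT _).smul_left _),
    m₁, m₂, m₃, m₄, m₅, hE]
  -- Sorting the commuting coefficients into a fixed order leaves a polynomial identity.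
  have k₁ : ∀ z, φ₂ 1 * (φ₁ 1 * z) = φ₁ 1 * (φ₂ 1 * z) := hab.symm.left_comm
  have k₂ := hab.symm.eq
  have k₃ := hEa.eq
  have k₄ := hEb.eq
  have k₅ := hEa.left_comm
  have k₆ := hEb.left_comm
  generalize Complex.I • r = E at *
  simp only [pow_succ, pow_zero, one_mul, mul_add, add_mul, mul_sub, mul_assoc,
    mul_smul_comm, smul_mul_assoc, neg_mul, k₁, k₂, k₃, k₄, k₅, k₆]
  abel

end Star

/-! ### Lower bounds under cubing -/

section LowerBound

variable {B : Type*} [CStarAlgebra B] [PartialOrder B] [StarOrderedRing B]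

/-- The tangent line at `t` bounds the cube from below. -/
theorem CStarAlgebra.smul_le_pow_three_add {s : B} (hs : 0 ≤ s) {t : ℝ} (ht : 0 ≤ t) :
    (3 * t ^ 2) • s ≤ s ^ 3 + algebraMap ℝ B (2 * t ^ 3) := by
  have hsa : IsSelfAdjoint (s - algebraMap ℝ B t) :=
    (IsSelfAdjoint.of_nonneg hs).sub (.algebraMap _ (.all t))
  -- `s³ - 3t²s + 2t³ = (s - t)(s + 2t)(s - t)`.
  have h := hsa.conjugate_nonneg (add_nonneg hs
    (algebraMap_nonneg B (mul_nonneg zero_le_two ht)))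
  rw [← sub_nonneg]
  convert h using 1
  simp only [Algebra.algebraMap_eq_smul_one, pow_succ, pow_zero, one_mul, mul_add, add_mul, mul_sub,
    sub_mul, smul_mul_assoc, mul_smul_comm, mul_one, smul_smul, smul_add, smul_sub, mul_assoc]
  module

/-- The tangent at `ε` gives `s³ ≥ 3ε²s - 2ε³ ≥ ε³ - 3ε²c`, and `ε ≤ 1/2` ensures `3ε² ≤ 1`. -/
theorem CStarAlgebra.algebraMap_le_pow_three_add {s c : B} (hs : 0 ≤ s) (hc : 0 ≤ c) {ε : ℝ}
    (hε : 0 ≤ ε) (hε' : ε ≤ 1 / 2) (h : algebraMap ℝ B ε ≤ s + c) :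
    algebraMap ℝ B (ε ^ 3) ≤ s ^ 3 + c := by
  have h₁ := CStarAlgebra.smul_le_pow_three_add hs hε
  have h₂ : (3 * ε ^ 2) • c ≤ c := by
    have : 0 ≤ (1 - 3 * ε ^ 2) • c := smul_nonneg (by nlinarith) hc
    rw [← sub_nonneg]
    convert this using 1
    module
  have h₃ := smul_le_smul_of_nonneg_left h (show 0 ≤ 3 * ε ^ 2 by positivity)
  rw [smul_add] at h₃
  have h₄ := h₃.trans (add_le_add h₁ h₂)
  rw [← sub_nonneg] at h₄ ⊢
  convert h₄ using 1
  simp only [Algebra.algebraMap_eq_smul_one]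
  module

end LowerBound

/-! ### Iterated joins and normalisation -/

section Combine

variable {n : ℕ} {B : Type*} [CStarAlgebra B] [PartialOrder B] [StarOrderedRing B]

local notation "M" => CStarMatrix (Fin n) (Fin n) ℂ

theorem IsAlgOrderZero.exists_join {φ₁ φ₂ : M →ₗ[ℂ] B} (h₁ : IsAlgOrderZero φ₁)
    (h₂ : IsAlgOrderZero φ₂) (hc : ∀ x y, Commute (φ₁ x) (φ₂ y)) {G : Type*} [Group G]
    {ν : G →* unitary M} {β : G →* (B ≃⋆ₐ[ℂ] B)}
    (e₁ : IsEquivariant (adAction ν) β φ₁) (e₂ : IsEquivariant (adAction ν) β φ₂) :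
    ∃ φ : M →ₗ[ℂ] B, IsAlgOrderZero φ ∧ IsEquivariant (adAction ν) β φ ∧
      φ 1 = (φ₁ 1 + φ₂ 1) ^ 3 ∧
      ∀ z, (∀ x, Commute z (φ₁ x)) → (∀ x, Commute z (φ₂ x)) → ∀ x, Commute z (φ x) := by
  obtain ⟨F, hFF, hFs, hF⟩ := CStarMatrix.exists_flip n
  let c : B := 3 • ((φ₁ 1 + φ₂ 1) * (φ₁ 1 + φ₂ 1)) + 4 • (φ₁ 1 * φ₂ 1)
  have hs : 0 ≤ φ₁ 1 + φ₂ 1 := add_nonneg h₁.map_one_nonneg h₂.map_one_nonneg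
  have hc0 : 0 ≤ c := add_nonneg
    (nsmul_nonneg (Commute.mul_nonneg hs hs (.refl _)) 3)
    (nsmul_nonneg (Commute.mul_nonneg h₁.map_one_nonneg h₂.map_one_nonneg
      (hc 1 1)) 4)
  let r := CFC.sqrt c
  have hr0 : 0 ≤ r := CFC.sqrt_nonneg c
  have hrr : r * r = c := CFC.sqrt_mul_sqrt_self c hc0
  have hr {z : B} (hz₁ : Commute z (φ₁ 1)) (hz₂ : Commute z (φ₂ 1)) : Commute z r := by
    have hz := hz₁.add_right hz₂
    have : Commute z c :=
      ((hz.mul_right hz).smul_right 3).add_right ((hz₁.mul_right hz₂).smul_right 4)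
    exact (this.symm.cfcₙ_nnreal _).symm
  have hr₁ x : Commute r (φ₁ x) := (hr (h₁.commute_map_one x).symm (hc x 1)).symm
  have hr₂ x : Commute r (φ₂ x) := (hr (hc 1 x).symm (h₂.commute_map_one x).symm).symm
  refine ⟨joinMap φ₁ φ₂ F r, ⟨joinMap_star h₁ h₂ hc hFs (.of_nonneg hr0) hr₁ hr₂,
    joinMap_mul h₁ h₂ hc hFF hF hrr hr₁ hr₂, ?_⟩, ?_, joinMap_one hc F r,
    fun z hz₁ hz₂ x ↦ commute_joinMap (hr (hz₁ 1) (hz₂ 1)) hz₁ hz₂ x⟩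
  · rw [joinMap_one hc]
    exact CStarAlgebra.pow_nonneg hs 3
  · intro g x
    have e₁' : β g (φ₁ 1) = φ₁ 1 := by rw [← e₁, map_one]
    have e₂' : β g (φ₂ 1) = φ₂ 1 := by rw [← e₂, map_one]
    -- The positive square root is unique and `β g` fixes `c`.
    have hβr : β g r = r := by
      refine (CFC.sqrt_unique ?_ (map_nonneg (β g) hr0)).symm
      rw [← _root_.map_mul, hrr]
      simp only [c, map_add, _root_.map_mul, map_nsmul, e₁', e₂']
    have hu : (ν g : M) * star (ν g : M) = 1 := Unitary.mul_star_self_of_mem (ν g).2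
    exact joinMap_equivariant (adAction ν g : M ≃⋆ₐ[ℂ] M).toAlgEquiv.toAlgHom
      (β g).toAlgEquiv.toAlgHom (flip_map_conj hF hu _ fun _ ↦ rfl) hβr (e₁ g) (e₂ g) x

/-- Induction on `m` with `φ` as accumulator: each step joins `ψ 0` into `φ` and replaces `ε` by `ε
^ 3`. -/
theorem exists_isAlgOrderZero_of_commuting {G : Type*} [Group G]
    (ν : G →* unitary M) (β : G →* (B ≃⋆ₐ[ℂ] B)) (m : ℕ) (φ : M →ₗ[ℂ] B)
    (ψ : Fin m → M →ₗ[ℂ] B) (hφ : IsAlgOrderZero φ) (eφ : IsEquivariant (adAction ν) β φ)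
    (hψ : ∀ j, IsAlgOrderZero (ψ j)) (eψ : ∀ j, IsEquivariant (adAction ν) β (ψ j))
    (hc : ∀ j x y, Commute (φ x) (ψ j y))
    (hcomm : ∀ i j, i ≠ j → ∀ x y, Commute (ψ i x) (ψ j y)) (ε : ℝ) (hε : 0 < ε)
    (hε' : ε ≤ 1 / 2) (hsum : algebraMap ℝ B ε ≤ φ 1 + ∑ j, ψ j 1) :
    ∃ Φ : M →ₗ[ℂ] B, IsAlgOrderZero Φ ∧ IsEquivariant (adAction ν) β Φ ∧ IsUnit (Φ 1) := by
  induction m generalizing φ ε with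
  | zero =>
    rw [Finset.univ_eq_empty, Finset.sum_empty, add_zero] at hsum
    refine ⟨φ, hφ, eφ, CStarAlgebra.isUnit_of_le _ hsum ⟨algebraMap_nonneg B hε.le, ?_⟩⟩
    exact (isUnit_iff_ne_zero.2 hε.ne').map (algebraMap ℝ B)
  | succ m ih =>
    obtain ⟨φ', hφ', eφ', h1, hz⟩ := hφ.exists_join (hψ 0) (hc 0) eφ (eψ 0)
    refine ih φ' (fun j ↦ ψ j.succ) hφ' eφ' (fun j ↦ hψ _) (fun j ↦ eψ _) ?_
      (fun i j hij ↦ hcomm _ _ (by simpa using hij)) (ε ^ 3) (by positivity) ?_ ?_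
    · exact fun j x y ↦ (hz (ψ j.succ y) (fun x ↦ (hc _ x y).symm)
        (fun x ↦ hcomm _ _ (Fin.succ_ne_zero j) y x) x).symm
    · nlinarith [sq_nonneg ε, mul_nonneg hε.le hε.le]
    · rw [h1]
      rw [Fin.sum_univ_succ, ← add_assoc] at hsum
      exact CStarAlgebra.algebraMap_le_pow_three_add
        (add_nonneg hφ.map_one_nonneg (hψ 0).map_one_nonneg)
        (Finset.sum_nonneg fun j _ ↦ (hψ j.succ).map_one_nonneg) hε.le hε' hsum

/-- An order zero map whose value at `1` is invertible normalises to a unital homomorphism. -/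
theorem IsAlgOrderZero.exists_starAlgHom {φ : M →ₗ[ℂ] B} (h : IsAlgOrderZero φ)
    (hu : IsUnit (φ 1)) {G : Type*} [Group G] {ν : G →* unitary M} {β : G →* (B ≃⋆ₐ[ℂ] B)}
    (e : IsEquivariant (adAction ν) β φ) :
    ∃ Ψ : M →⋆ₐ[ℂ] B, IsEquivariant (adAction ν) β Ψ := by
  obtain ⟨u, hu⟩ := hu
  have hc x : Commute (↑u⁻¹ : B) (φ x) := by
    have := h.commute_map_one x
    rw [← hu] at this
    exact this.units_inv_left
  have hus : star (↑u⁻¹ : B) = ↑u⁻¹ := by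
    have hsa : star u = u := Units.ext (by rw [Units.coe_star, hu, ← h.map_star, star_one])
    rw [← Units.coe_star, star_inv, hsa]
  let f : M →ₐ[ℂ] B := AlgHom.ofLinearMap (LinearMap.mulLeft ℂ (↑u⁻¹ : B) ∘ₗ φ)
    (by simp [← hu]) (fun x y ↦ by
      simp only [LinearMap.comp_apply, LinearMap.mulLeft_apply]
      rw [(hc x).symm.mul_mul_mul_comm, h.map_mul, ← hu, mul_assoc, Units.inv_mul_cancel_left])
  refine ⟨⟨f, fun x ↦ ?_⟩, fun g x ↦ ?_⟩
  · change ↑u⁻¹ * φ (star x) = star (↑u⁻¹ * φ x)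
    rw [star_mul, hus, ← h.map_star, (hc _).eq]
  · change ↑u⁻¹ * φ (adAction ν g x) = β g (↑u⁻¹ * φ x)
    have hβ : β g (φ 1) = φ 1 := by rw [← e, map_one]
    have hx : φ x = φ 1 * (↑u⁻¹ * φ x) := by rw [← hu, Units.mul_inv_cancel_left]
    rw [e, Units.inv_mul_eq_iff_eq_mul, hu]
    conv_lhs => rw [hx, _root_.map_mul, hβ]

end Combine

theorem mainTheorem12 {G : Type*} [Group G] [Countable G]
    {B : Type*} [CStarAlgebra B] [PartialOrder B] [StarOrderedRing B]
    (β : G →* (B ≃⋆ₐ[ℂ] B))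
    (n : ℕ) (ν : G →* unitary (CStarMatrix (Fin n) (Fin n) ℂ))
    (m : ℕ) (ψ : Fin m → (CStarMatrix (Fin n) (Fin n) ℂ →CP B))
    (hψ : ∀ j, IsCPCOrderZero (ψ j))
    (hequiv : ∀ j, IsEquivariant (adAction ν) β (ψ j))
    (hcomm : ∀ i j, i ≠ j → ∀ x y, Commute (ψ i x) (ψ j y))
    (hsum : ∑ j, ψ j 1 = 1) :
    ∃ Ψ : CStarMatrix (Fin n) (Fin n) ℂ →⋆ₐ[ℂ] B, IsEquivariant (adAction ν) β Ψ := by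
  -- The accumulator starts at the zero map; the sum is `1`, but the cubing bound needs `ε ≤ 1/2`.
  obtain ⟨Φ, hΦ, eΦ, hu⟩ := exists_isAlgOrderZero_of_commuting ν β m 0
    (fun j ↦ (ψ j : CStarMatrix (Fin n) (Fin n) ℂ →ₗ[ℂ] B))
    ⟨by simp, by simp, by simp⟩ (fun g x ↦ by simp) (fun j ↦ (hψ j).isAlgOrderZero) hequiv
    (fun j x y ↦ Commute.zero_left _) hcomm (1 / 2) (by norm_num) le_rfl (by
      have h : algebraMap ℝ B (1 / 2) ≤ algebraMap ℝ B 1 := algebraMap_mono B (by norm_num)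
      rw [map_one] at h
      simpa [hsum] using h)
  exact hΦ.exists_starAlgHom hu eΦ
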